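/- Let $q\ge 3$ be a prime power, $m\ge 2$, $n=q^m-1$, and let $c$ be an integer with $2\le c\le q$ and $(c-1)q+1<\lfloor q^{\lceil m/2\rceil}-1\rfloor$. Put $k=n-m(2c-3)-1$ (a nonnegative integer under these hypotheses). Then there exists an $[[n,\,k,\,d\ge c]]_q$ CSS quantum code: there are linear codes $C_2\subseteq C_1\subseteq\mathbb F_q^n$ such that the CSS code $$Q(C_1,C_2)=\operatorname{span}_{\mathbb C}\Bigl\{\sum_{y\in C_2}|x+y\rangle : x\in C_1\Bigr\}\subseteq(\mathbb C^q)^{\otimes n}$$ has dimension $q^k$ and minimum distance $d\ge c$. Here the minimum distance of a quantum code $Q$ of dimension greater than one is the largest $d$ such that every operator $E$ acting nontrivially on fewer than $d$ qudits is detected, i.e. $\langle u|E|v\rangle=\lambda_E\langle u|v\rangle$ for all $u,v\in Q$, with $\lambda_E$ depending only on $E$. Moreover, such codes are given by cyclotomic cosets. Let $\mathbb C_s=\{sq^j \bmod n: j\ge 0\}$ be the $q$-coset of $s$ modulo $n$, let $\alpha$ be any primitive element of $\mathbb F_{q^m}$, and for a union $Z$ of $q$-cosets let the cyclic code of length $n$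 over $\mathbb F_q$ with defining set $Z$ be the one generated by the product of the distinct minimal polynomials over $\mathbb F_q$ of the $\alpha^i$, $i\in Z$. Then one can take for $C_1$ the cyclic code with defining set $\mathbb C_0\cup\mathbb C_1\cup\dots\cup\mathbb C_{c-2}$ and for $C_2$ the cyclic code whose defining set is the complement in $\{0,\dots,n-1\}$ of $\mathbb C_{q+1}\cup\mathbb C_{2q+1}\cup\dots\cup\mathbb C_{(c-1)q+1}$. -/

import Mathlib

open scoped Matrix Polynomial

noncomputable section

/-! ### Quantum codes

The state space of `n` qudits with alphabet `A` (`q = |A|`) is `(ℂ^q)^{⊗ n}`.  A state is given by its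
coordinates in the computational basis `|x⟩`, `x ∈ A^n`, that is, by a function `(Fin n → A) → ℂ`; the
Hermitian inner product of `u` and `v` is `star u ⬝ᵥ v`, and operators are matrices. -/

/-- `E` acts only on the qudits in `S`: it is a tensor product `M ⊗ 1`, where `M` is an arbitrary operator
on the qudits in `S` and `1` is the identity on all the other qudits. -/
def ActsOn {A : Type*} {n : ℕ} (S : Finset (Fin n))
    (E : Matrix (Fin n → A) (Fin n → A) ℂ) : Prop :=
  ∃ M : Matrix (S → A) (S → A) ℂ, ∀ x y : Fin n → A,
    ((∀ i, i ∉ S → x i = y i) → E x y = M (fun i => x i) (fun i => y i)) ∧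
    ((¬ ∀ i, i ∉ S → x i = y i) → E x y = 0)

/-- The quantum code `Q` detects the error operator `E`: `⟨u|E|v⟩ = z ⟨u|v⟩` for all `u, v ∈ Q`, with a
constant `z` that depends on `E` only (equivalently `P E P = z P` for the orthogonal projection `P`
onto `Q`). -/
def Detects {A : Type*} [Fintype A] {n : ℕ} (Q : Submodule ℂ ((Fin n → A) → ℂ))
    (E : Matrix (Fin n → A) (Fin n → A) ℂ) : Prop :=
  ∃ z : ℂ, ∀ u ∈ Q, ∀ v ∈ Q, star u ⬝ᵥ (E *ᵥ v) = z * (star u ⬝ᵥ v)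

/-- `d` is the minimum distance of the quantum code `Q`: the largest `d` such that every error operator
acting on fewer than `d` qudits is detected.  (Used for codes of dimension greater than one.) -/
def IsMinDist {A : Type*} [Fintype A] {n : ℕ} (Q : Submodule ℂ ((Fin n → A) → ℂ)) (d : ℕ) : Prop :=
  IsGreatest {d : ℕ | ∀ S : Finset (Fin n), S.card < d →
    ∀ E : Matrix (Fin n → A) (Fin n → A) ℂ, ActsOn S E → Detects Q E} d

/-- `Q` is an `[[n, k, d]]_q` quantum code, `q = |A|`: a subspace of `(ℂ^q)^{⊗ n}` of dimension `q ^ k`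
and of minimum distance `d`. -/
def HasParameters {A : Type*} [Fintype A] {n : ℕ} (Q : Submodule ℂ ((Fin n → A) → ℂ))
    (k d : ℕ) : Prop :=
  Module.finrank ℂ Q = Fintype.card A ^ k ∧ IsMinDist Q d

/-! ### The CSS construction -/

/-- The (unnormalised) coset state `∑_{y ∈ C₂} |x + y⟩`. -/
def cosetState {F : Type*} [Field F] {n : ℕ} (C₂ : Submodule F (Fin n → F)) (x : Fin n → F) :
    (Fin n → F) → ℂ :=
  Set.indicator {y | y - x ∈ C₂} 1

/-- The CSS code of `C₂ ⊆ C₁`: the span of the states `∑_{y ∈ C₂} |x + y⟩`, `x ∈ C₁`. -/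
def cssCode {F : Type*} [Field F] {n : ℕ} (C₁ C₂ : Submodule F (Fin n → F)) :
    Submodule ℂ ((Fin n → F) → ℂ) :=
  Submodule.span ℂ (cosetState C₂ '' (C₁ : Set (Fin n → F)))

/-! ### Cyclotomic cosets and cyclic codes -/

open Classical in
/-- The `q`-coset of `s` modulo `n`: all `s * q ^ j mod n`, as integers in `[0, n)`. -/
def qCoset (q n s : ℕ) : Finset ℕ :=
  (Finset.range n).filter fun t => ∃ j : ℕ, s * q ^ j ≡ t [MOD n]

open Classical in
/-- The product of the distinct minimal polynomials over `F` of the powers `α ^ i`, `i ∈ Z`. -/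
def genPoly (F : Type*) {K : Type*} [Field F] [Field K] [Algebra F K] (α : K) (Z : Finset ℕ) : F[X] :=
  ∏ M ∈ Z.image (fun i => minpoly F (α ^ i)), M

/-- The cyclic code of length `n` generated by `g` (a divisor of `X ^ n - 1`): the words
`(v₀, …, v_{n-1})` whose polynomial `∑ i, v_i X ^ i` is a multiple of `g`. -/
def cyclicCode {F : Type*} [Field F] (n : ℕ) (g : F[X]) : Submodule F (Fin n → F) where
  carrier := {v | g ∣ ∑ i : Fin n, Polynomial.C (v i) * Polynomial.X ^ (i : ℕ)}
  zero_mem' := by simp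
  add_mem' := by
    intro a b ha hb
    simpa [add_mul, Finset.sum_add_distrib] using dvd_add ha hb
  smul_mem' := by
    intro r a ha
    have h := Dvd.dvd.mul_left ha (Polynomial.C r)
    simpa [Finset.mul_sum, mul_assoc] using h

/-- The code with defining set `C_0 ∪ C_1 ∪ … ∪ C_{c-2}`. -/
def codeOne (F : Type*) {K : Type*} [Field F] [Field K] [Algebra F K] (q n c : ℕ) (α : K) :
    Submodule F (Fin n → F) :=
  cyclicCode n (genPoly F α ((Finset.range (c - 1)).biUnion fun i => qCoset q n i))

/-- The code whose defining set is the complement, in `{0, …, n - 1}`, of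
`C_{q+1} ∪ C_{2q+1} ∪ … ∪ C_{(c-1)q+1}`. -/
def codeTwo (F : Type*) {K : Type*} [Field F] [Field K] [Algebra F K] (q n c : ℕ) (α : K) :
    Submodule F (Fin n → F) :=
  cyclicCode n (genPoly F α
    (Finset.range n \ (Finset.Icc 1 (c - 1)).biUnion fun j => qCoset q n (j * q + 1)))

end

section CSS

variable {F : Type*} [Field F] {n : ℕ} {C₁ C₂ : Submodule F (Fin n → F)}

theorem cosetState_apply_of_mem {x y : Fin n → F} (h : y - x ∈ C₂) : cosetState C₂ x y = 1 :=
  Set.indicator_of_mem (s := {y | y - x ∈ C₂}) h 1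

theorem cosetState_apply_of_notMem {x y : Fin n → F} (h : y - x ∉ C₂) : cosetState C₂ x y = 0 :=
  Set.indicator_of_notMem (s := {y | y - x ∈ C₂}) h 1

theorem star_cosetState (x : Fin n → F) : star (cosetState C₂ x) = cosetState C₂ x := by
  ext y
  by_cases h : y - x ∈ C₂
  · simp [cosetState_apply_of_mem h]
  · simp [cosetState_apply_of_notMem h]

theorem cosetState_eq_of_sub_mem {x y : Fin n → F} (h : x - y ∈ C₂) :
    cosetState C₂ x = cosetState C₂ y := by
  have : {z | z - x ∈ C₂} = {z | z - y ∈ C₂} := by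
    ext z
    simp only [Set.mem_ofPred_eq]
    rw [show z - y = (z - x) + (x - y) by abel]
    exact (C₂.add_mem_iff_left h).symm
  rw [cosetState, cosetState, this]

theorem sub_mem_of_cosetState_apply {x y : Fin n → F} (h : cosetState C₂ x y ≠ 0) :
    y - x ∈ C₂ := by
  by_contra h'
  exact h (cosetState_apply_of_notMem h')

variable [Fintype F]

/-- The dimension of a CSS code. -/
theorem finrank_cssCode (h : C₂ ≤ C₁) :
    Module.finrank ℂ (cssCode C₁ C₂) =
      Fintype.card F ^ (Module.finrank F C₁ - Module.finrank F C₂) := by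
  classical
  let D : Submodule F C₁ := C₂.comap C₁.subtype
  let b : (C₁ ⧸ D) → ((Fin n → F) → ℂ) := fun a => cosetState C₂ (a.out : C₁)
  have hout (x : C₁) : ((D.mkQ x).out : C₁) - x ∈ D := by
    rw [← Submodule.Quotient.eq]
    exact Quotient.out_eq _
  have hb : Set.range b = cosetState C₂ '' (C₁ : Set (Fin n → F)) := by
    ext f
    constructor
    · rintro ⟨a, rfl⟩
      exact ⟨_, (a.out : C₁).2, rfl⟩
    · rintro ⟨x, hx, rfl⟩
      exact ⟨D.mkQ ⟨x, hx⟩, cosetState_eq_of_sub_mem (hout ⟨x, hx⟩)⟩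
  have hba (a : C₁ ⧸ D) : b a = cosetState C₂ (a.out : C₁) := rfl
  have hli : LinearIndependent ℂ b := by
    rw [Fintype.linearIndependent_iff]
    intro g hg a
    have h1 := congrFun hg ((a.out : C₁) : Fin n → F)
    simp only [Finset.sum_apply, Pi.smul_apply, smul_eq_mul, Pi.zero_apply] at h1
    rw [Finset.sum_eq_single a] at h1
    · rwa [hba, cosetState_apply_of_mem (by simp), mul_one] at h1
    · intro a' _ hne
      rw [hba, cosetState_apply_of_notMem, mul_zero]
      intro hmem
      apply hne
      have : (a.out : C₁) - (a'.out : C₁) ∈ D := hmem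
      rw [← Submodule.Quotient.eq] at this
      rw [← Quotient.out_eq a, ← Quotient.out_eq a']
      exact this.symm
    · simp
  have hD : Module.finrank F D = Module.finrank F C₂ :=
    (Submodule.comapSubtypeEquivOfLe h).finrank_eq
  have hQ := D.finrank_quotient_add_finrank
  rw [cssCode, ← hb, finrank_span_eq_card hli, ← Nat.card_eq_fintype_card,
    ← Nat.card_eq_fintype_card, Module.natCard_eq_pow_finrank (K := F)]
  congr 1
  omega

theorem detects_span_of_generators {A : Type*} [Fintype A] {s : Set ((Fin n → A) → ℂ)}
    {E : Matrix (Fin n → A) (Fin n → A) ℂ} {z : ℂ}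
    (h : ∀ u ∈ s, ∀ v ∈ s, star u ⬝ᵥ (E *ᵥ v) = z * (star u ⬝ᵥ v)) :
    Detects (Submodule.span ℂ s) E := by
  refine ⟨z, fun u hu v hv => ?_⟩
  induction hu, hv using Submodule.span_induction₂ with
  | mem_mem u v hu hv => exact h u hu v hv
  | zero_left => simp
  | zero_right => simp
  | add_left x y z _ _ _ h1 h2 => simp only [star_add, add_dotProduct, h1, h2, mul_add]
  | add_right x y z _ _ _ h1 h2 => simp only [Matrix.mulVec_add, dotProduct_add, h1, h2, mul_add]
  | smul_left r x y _ _ h1 => simp only [star_smul, smul_dotProduct, h1, smul_eq_mul]; ring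
  | smul_right r x y _ _ h1 => simp only [Matrix.mulVec_smul, dotProduct_smul, h1, smul_eq_mul]; ring

/-- A CSS code detects every error on `S` if no nonzero word of `C₁` is supported in `S` and `C₂` projects
onto the coordinates in `S`. -/
theorem detects_cssCode (h : C₂ ≤ C₁) (S : Finset (Fin n))
    (h₁ : ∀ v ∈ C₁, (∀ i, i ∉ S → v i = 0) → v = 0)
    (h₂ : ∀ w : Fin n → F, ∃ v ∈ C₂, ∀ i ∈ S, v i = w i)
    {E : Matrix (Fin n → F) (Fin n → F) ℂ} (hE : ActsOn S E) :
    Detects (cssCode C₁ C₂) E := by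
  classical
  obtain ⟨M, hM⟩ := hE
  have hdiag (a : Fin n → F) : E a a = M (fun i => a i) (fun i => a i) :=
    (hM a a).1 fun _ _ => rfl
  have hoff {a b : Fin n → F} (hab : a - b ∈ C₁) (hne : a ≠ b) : E a b = 0 := by
    refine (hM a b).2 fun hall => hne ?_
    exact sub_eq_zero.1 (h₁ _ hab fun i hi => by simp [hall i hi])
  have hexp (x y : Fin n → F) (hx : x ∈ C₁) (hy : y ∈ C₁) :
      star (cosetState C₂ x) ⬝ᵥ (E *ᵥ cosetState C₂ y) =
        ∑ a, cosetState C₂ x a * cosetState C₂ y a * E a a := by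
    rw [star_cosetState, dotProduct]
    refine Finset.sum_congr rfl fun a _ => ?_
    rw [mul_assoc]
    by_cases ha : cosetState C₂ x a = 0
    · simp [ha]
    have ha' := sub_mem_of_cosetState_apply ha
    congr 1
    rw [Matrix.mulVec, dotProduct, Finset.sum_eq_single a, mul_comm]
    · intro b _ hba
      by_cases hb : cosetState C₂ y b = 0
      · simp [hb]
      have hb' := sub_mem_of_cosetState_apply hb
      rw [hoff _ hba.symm, zero_mul]
      rw [show a - b = (a - x) + x - ((b - y) + y) by abel]
      exact C₁.sub_mem (C₁.add_mem (h ha') hx) (C₁.add_mem (h hb') hy)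
    · simp
  have hshift (g : (Fin n → F) → ℂ) (x : Fin n → F) :
      ∑ a, cosetState C₂ x a * g a = ∑ a, cosetState C₂ 0 a * g (x + a) := by
    rw [← Equiv.sum_comp (Equiv.addLeft x) fun a => cosetState C₂ x a * g a]
    refine Finset.sum_congr rfl fun a _ => ?_
    simp only [Equiv.coe_addLeft]
    congr 1
    by_cases ha : a ∈ C₂
    · rw [cosetState_apply_of_mem (by simpa), cosetState_apply_of_mem (by simpa)]
    · rw [cosetState_apply_of_notMem (by simpa), cosetState_apply_of_notMem (by simpa)]
  have hconst (x : Fin n → F) :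
      ∑ a, cosetState C₂ x a * E a a = ∑ a, cosetState C₂ 0 a * E a a := by
    obtain ⟨y, hy, hyx⟩ := h₂ x
    rw [← cosetState_eq_of_sub_mem (C₂ := C₂) (x := y) (y := 0) (by simpa), hshift _ x, hshift _ y]
    refine Finset.sum_congr rfl fun a _ => ?_
    have : (fun i : S => (x + a) i) = fun i : S => (y + a) i := by
      ext i
      simp [hyx i i.2]
    rw [hdiag, hdiag, this]
  have hsq (x a : Fin n → F) : cosetState C₂ x a * cosetState C₂ x a = cosetState C₂ x a := by
    by_cases ha : a - x ∈ C₂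
    · simp [cosetState_apply_of_mem ha]
    · simp [cosetState_apply_of_notMem ha]
  have hnorm : ∑ a, cosetState C₂ 0 a ≠ 0 := by
    have : ∑ a, cosetState C₂ 0 a = (Finset.univ.filter fun a => a ∈ C₂).card := by
      rw [Finset.card_filter, Nat.cast_sum]
      refine Finset.sum_congr rfl fun a _ => ?_
      by_cases ha : a ∈ C₂
      · simp [cosetState_apply_of_mem (C₂ := C₂) (x := 0) (y := a) (by simpa), ha]
      · simp [cosetState_apply_of_notMem (C₂ := C₂) (x := 0) (y := a) (by simpa), ha]
    rw [this, Nat.cast_ne_zero]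
    exact Finset.card_ne_zero.2 ⟨0, by simp⟩
  refine detects_span_of_generators
    (z := (∑ a, cosetState C₂ 0 a * E a a) / ∑ a, cosetState C₂ 0 a) ?_
  rintro _ ⟨x, hx, rfl⟩ _ ⟨y, hy, rfl⟩
  rw [hexp x y hx hy, star_cosetState, dotProduct]
  by_cases hxy : x - y ∈ C₂
  · rw [← cosetState_eq_of_sub_mem hxy]
    simp only [hsq]
    have h1 := hshift (fun _ => 1) x
    simp only [mul_one] at h1
    rw [hconst, h1, div_mul_cancel₀ _ hnorm]
  · have h0 (a : Fin n → F) : cosetState C₂ x a * cosetState C₂ y a = 0 := by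
      by_contra hne
      have hx' := sub_mem_of_cosetState_apply (left_ne_zero_of_mul hne)
      have hy' := sub_mem_of_cosetState_apply (right_ne_zero_of_mul hne)
      apply hxy
      rw [show x - y = (a - y) - (a - x) by abel]
      exact C₂.sub_mem hy' hx'
    simp [h0]

/-- If `C₂` is a proper subcode of `C₁`, the CSS code does not detect all operators. -/
theorem exists_not_detects_cssCode (h : C₂ < C₁) :
    ∃ E, ¬ Detects (cssCode C₁ C₂) E := by
  classical
  obtain ⟨x, hx, hx'⟩ := SetLike.exists_of_lt h
  refine ⟨Matrix.single 0 0 1, ?_⟩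
  rintro ⟨z, hz⟩
  have hmem {y : Fin n → F} (hy : y ∈ C₁) : cosetState C₂ y ∈ cssCode C₁ C₂ :=
    Submodule.subset_span ⟨y, hy, rfl⟩
  have hval (y : Fin n → F) : star (cosetState C₂ y) ⬝ᵥ
      (Matrix.single 0 0 1 *ᵥ cosetState C₂ y) = cosetState C₂ y 0 * cosetState C₂ y 0 := by
    rw [star_cosetState, Matrix.single_mulVec, dotProduct, Finset.sum_eq_single 0]
    · simp
    · intro b _ hb
      simp [hb]
    · simp
  have h0 := hz _ (hmem C₁.zero_mem) _ (hmem C₁.zero_mem)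
  have h1 := hz _ (hmem hx) _ (hmem hx)
  rw [hval, cosetState_apply_of_mem (by simp)] at h0
  rw [hval, cosetState_apply_of_notMem (by simpa)] at h1
  have hz0 : z ≠ 0 := by
    rintro rfl
    simp at h0
  have h2 : star (cosetState C₂ x) ⬝ᵥ cosetState C₂ x = 0 := by
    simpa [hz0] using h1.symm
  open scoped ComplexOrder in rw [dotProduct_star_self_eq_zero] at h2
  have h3 := congrFun h2 x
  rw [cosetState_apply_of_mem (by simp)] at h3
  simp at h3

/-- The parameters of a CSS code, from the weights of `C₁` and the projections of `C₂`. -/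
theorem exists_hasParameters_cssCode {c k : ℕ} (h : C₂ ≤ C₁) (hk : 0 < k)
    (hdim : Module.finrank F C₁ = Module.finrank F C₂ + k)
    (h₁ : ∀ S : Finset (Fin n), S.card < c → ∀ v ∈ C₁, (∀ i, i ∉ S → v i = 0) → v = 0)
    (h₂ : ∀ S : Finset (Fin n), S.card < c → ∀ w : Fin n → F, ∃ v ∈ C₂, ∀ i ∈ S, v i = w i) :
    ∃ d : ℕ, c ≤ d ∧ HasParameters (cssCode C₁ C₂) k d := by
  let D : Set ℕ := {d : ℕ | ∀ S : Finset (Fin n), S.card < d →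
    ∀ E : Matrix (Fin n → F) (Fin n → F) ℂ, ActsOn S E → Detects (cssCode C₁ C₂) E}
  have hc : c ∈ D := fun S hS E hE => detects_cssCode h S (h₁ S hS) (h₂ S hS) hE
  have hbdd : BddAbove D := by
    refine ⟨n, fun d hd => ?_⟩
    by_contra! hlt
    have hlt' : C₂ < C₁ := lt_of_le_of_ne h (by rintro rfl; omega)
    obtain ⟨E, hE⟩ := exists_not_detects_cssCode hlt'
    refine hE (hd Finset.univ (by simpa using hlt) E
      ⟨fun a b => E (fun i => a ⟨i, Finset.mem_univ i⟩) (fun i => b ⟨i, Finset.mem_univ i⟩),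
        fun x y => ⟨fun _ => rfl, fun hxy => ?_⟩⟩)
    exact absurd (fun i hi => absurd (Finset.mem_univ i) hi) hxy
  refine ⟨sSup D, le_csSup hbdd hc, ?_, Nat.sSup_mem ⟨c, hc⟩ hbdd, fun d hd => le_csSup hbdd hd⟩
  rw [finrank_cssCode h, hdim, Nat.add_sub_cancel_left]

end CSS

section Vandermonde

/-- A vector with support in `S` whose first `|S|` power moments at distinct nodes vanish is zero. -/
theorem eq_zero_of_sum_mul_pow_eq_zero {ι K : Type*} [Field K] {S : Finset ι} {a b : ι → K}
    (ha : Set.InjOn a S) (h : ∀ j < S.card, ∑ i ∈ S, b i * a i ^ j = 0) : ∀ i ∈ S, b i = 0 := by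
  classical
  intro i hi
  have hpoly (p : K[X]) (hp : p.natDegree < S.card) : ∑ i ∈ S, b i * p.eval (a i) = 0 := by
    simp only [Polynomial.eval_eq_sum_range, Finset.mul_sum]
    rw [Finset.sum_comm]
    refine Finset.sum_eq_zero fun j hj => ?_
    have := h j (by rw [Finset.mem_range] at hj; omega)
    calc ∑ i ∈ S, b i * (p.coeff j * a i ^ j) = p.coeff j * ∑ i ∈ S, b i * a i ^ j := by
          rw [Finset.mul_sum]
          exact Finset.sum_congr rfl fun _ _ => by ring
      _ = 0 := by rw [this, mul_zero]
  have hdeg : (∏ k ∈ S.erase i, (Polynomial.X - Polynomial.C (a k))).natDegree < S.card := by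
    rw [Polynomial.natDegree_finsetProd_X_sub_C_eq_card]
    exact Finset.card_erase_lt_of_mem hi
  have h1 := hpoly _ hdeg
  rw [Finset.sum_eq_single_of_mem i hi] at h1
  · refine (mul_eq_zero.1 h1).resolve_right ?_
    rw [Polynomial.eval_prod, ← ne_eq, Finset.prod_ne_zero_iff]
    intro k hk
    rw [Polynomial.eval_sub, Polynomial.eval_X, Polynomial.eval_C, sub_ne_zero]
    rw [Finset.mem_erase] at hk
    exact fun he => hk.1 (ha hi hk.2 he).symm
  · intro k hk hki
    rw [Polynomial.eval_prod, Finset.prod_eq_zero (Finset.mem_erase.2 ⟨hki, hk⟩) (by simp), mul_zero]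

end Vandermonde

section CyclicCode

variable {F : Type*} [Field F] {n : ℕ}

/-- The polynomial of a word. -/
noncomputable def wordPoly (F : Type*) [Field F] (n : ℕ) : (Fin n → F) →ₗ[F] F[X] where
  toFun v := ∑ i : Fin n, Polynomial.C (v i) * Polynomial.X ^ (i : ℕ)
  map_add' u v := by simp [add_mul, Finset.sum_add_distrib]
  map_smul' r v := by simp [Finset.mul_sum, Polynomial.smul_eq_C_mul, mul_assoc]

theorem wordPoly_apply (v : Fin n → F) :
    wordPoly F n v = ∑ i : Fin n, Polynomial.C (v i) * Polynomial.X ^ (i : ℕ) := rfl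

theorem mem_cyclicCode {g : F[X]} {v : Fin n → F} : v ∈ cyclicCode n g ↔ g ∣ wordPoly F n v :=
  Iff.rfl

theorem exists_wordPoly_eq {p : F[X]} (hp : p ∈ Polynomial.degreeLT F n) :
    ∃ v, wordPoly F n v = p := by
  refine ⟨fun i => p.coeff i, ?_⟩
  rw [Polynomial.mem_degreeLT] at hp
  rw [wordPoly_apply, Fin.sum_univ_eq_sum_range fun i => Polynomial.C (p.coeff i) * Polynomial.X ^ i]
  by_cases h0 : p = 0
  · simp [h0]
  exact (p.as_sum_range_C_mul_X_pow' ((Polynomial.natDegree_lt_iff_degree_lt h0).2 hp)).symm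

theorem finrank_cyclicCode {g : F[X]} (hg : g.Monic) (hdeg : g.natDegree ≤ n) :
    Module.finrank F (cyclicCode n g) + g.natDegree = n := by
  let φ : (Fin n → F) →ₗ[F] AdjoinRoot g := (AdjoinRoot.mkₐ g).toLinearMap ∘ₗ wordPoly F n
  have hker : LinearMap.ker φ = cyclicCode n g := by
    ext v
    rw [LinearMap.mem_ker, mem_cyclicCode]
    exact AdjoinRoot.mk_eq_zero
  have hsurj : LinearMap.range φ = ⊤ := by
    rw [LinearMap.range_eq_top]
    intro x
    obtain ⟨p, rfl⟩ := AdjoinRoot.mk_surjective x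
    obtain ⟨v, hv⟩ := exists_wordPoly_eq (n := n) (p := p %ₘ g) (by
      rw [Polynomial.mem_degreeLT]
      refine (Polynomial.degree_modByMonic_lt p hg).trans_le ?_
      rw [Polynomial.degree_eq_natDegree hg.ne_zero]
      exact_mod_cast hdeg)
    refine ⟨v, ?_⟩
    change AdjoinRoot.mk g (wordPoly F n v) = _
    rw [hv, AdjoinRoot.mk_eq_mk]
    refine ⟨-(p /ₘ g), ?_⟩
    linear_combination p.modByMonic_add_div g
  have h1 := LinearMap.finrank_range_add_finrank_ker φ
  have h2 : Module.finrank F (AdjoinRoot g) = g.natDegree := by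
    rw [(AdjoinRoot.powerBasis' hg).finrank, AdjoinRoot.powerBasis'_dim]
  rw [hsurj, finrank_top, h2, hker, Module.finrank_fin_fun] at h1
  omega

variable {K : Type*} [Field K] [Algebra F K]

theorem aeval_wordPoly (v : Fin n → F) (x : K) :
    Polynomial.aeval x (wordPoly F n v) = ∑ i : Fin n, algebraMap F K (v i) * x ^ (i : ℕ) := by
  simp [wordPoly_apply]

variable [FiniteDimensional F K]

theorem genPoly_monic (α : K) (Z : Finset ℕ) : (genPoly F α Z).Monic := by
  classical
  refine Polynomial.monic_prod_of_monic _ _ fun M hM => ?_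
  obtain ⟨i, -, rfl⟩ := Finset.mem_image.1 hM
  exact minpoly.monic (Algebra.IsIntegral.isIntegral _)

theorem genPoly_dvd_iff {α : K} {Z : Finset ℕ} {p : F[X]} :
    genPoly F α Z ∣ p ↔ ∀ z ∈ Z, Polynomial.aeval (α ^ z) p = 0 := by
  classical
  constructor
  · intro h z hz
    rw [← minpoly.dvd_iff]
    exact (Finset.dvd_prod_of_mem (fun M => M) (Finset.mem_image_of_mem _ hz)).trans h
  · intro h
    refine Finset.prod_dvd_of_coprime ?_ ?_
    · intro M hM N hN hne
      obtain ⟨i, -, rfl⟩ := Finset.mem_image.1 hM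
      obtain ⟨j, -, rfl⟩ := Finset.mem_image.1 hN
      have hi := Algebra.IsIntegral.isIntegral (R := F) (α ^ i)
      have hj := Algebra.IsIntegral.isIntegral (R := F) (α ^ j)
      refine ((minpoly.irreducible hi).coprime_iff_not_dvd).2 fun hd => hne ?_
      exact Polynomial.eq_of_monic_of_associated (minpoly.monic hi) (minpoly.monic hj)
        ((minpoly.irreducible hi).associated_of_dvd (minpoly.irreducible hj) hd)
    · intro M hM
      obtain ⟨i, hi, rfl⟩ := Finset.mem_image.1 hM
      exact minpoly.dvd_iff.2 (h i hi)

theorem mem_cyclicCode_genPoly {α : K} {Z : Finset ℕ} {v : Fin n → F} :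
    v ∈ cyclicCode n (genPoly F α Z) ↔
      ∀ z ∈ Z, ∑ i : Fin n, algebraMap F K (v i) * (α ^ z) ^ (i : ℕ) = 0 := by
  simp only [mem_cyclicCode, genPoly_dvd_iff, aeval_wordPoly]

theorem cyclicCode_genPoly_anti {α : K} {Z Z' : Finset ℕ} (h : Z ⊆ Z') :
    cyclicCode n (genPoly F α Z') ≤ cyclicCode n (genPoly F α Z) := by
  intro v hv
  rw [mem_cyclicCode_genPoly] at hv ⊢
  exact fun z hz => hv z (h hz)

/-- The BCH bound for the defining set `{0, …, δ - 1}`. -/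
theorem eq_zero_of_mem_cyclicCode {α : K} (hα : IsPrimitiveRoot α n) {Z : Finset ℕ} {S : Finset (Fin n)}
    (hZ : ∀ j < S.card, j ∈ Z) {v : Fin n → F} (hv : v ∈ cyclicCode n (genPoly F α Z))
    (hS : ∀ i, i ∉ S → v i = 0) : v = 0 := by
  rw [mem_cyclicCode_genPoly] at hv
  have key := eq_zero_of_sum_mul_pow_eq_zero (S := S) (a := fun i : Fin n => α ^ (i : ℕ))
    (b := fun i => algebraMap F K (v i))
    (fun i _ j _ hij => Fin.ext (hα.pow_inj i.2 j.2 hij)) fun j hj => by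
      rw [← hv j (hZ j hj)]
      refine Finset.sum_subset_zero_on_sdiff (Finset.subset_univ S) ?_ ?_
      · intro i hi
        simp [hS i (by simpa using hi)]
      · intro i _
        rw [← pow_mul, ← pow_mul, mul_comm j]
  ext i
  by_cases hi : i ∈ S
  · simpa using key i hi
  · exact hS i hi

theorem natDegree_genPoly_range {α : K} (hn : 0 < n) (hα : IsPrimitiveRoot α n) :
    (genPoly F α (Finset.range n)).natDegree = n := by
  classical
  have hX : (Polynomial.X ^ n - 1 : F[X]).natDegree = n := by
    rw [← Polynomial.C_1]
    exact Polynomial.natDegree_X_pow_sub_C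
  have hX' : (Polynomial.X ^ n - 1 : K[X]).natDegree = n := by
    rw [← Polynomial.C_1]
    exact Polynomial.natDegree_X_pow_sub_C
  have h1 : genPoly F α (Finset.range n) ∣ Polynomial.X ^ n - 1 := by
    rw [genPoly_dvd_iff]
    intro z _
    simp [← pow_mul, mul_comm z, pow_mul α n, hα.pow_eq_one]
  have hroot := (genPoly_dvd_iff (α := α) (Z := Finset.range n)
    (p := genPoly F α (Finset.range n))).1 (dvd_refl _)
  have h2 : (Polynomial.X ^ n - 1 : K[X]) ∣ (genPoly F α (Finset.range n)).map (algebraMap F K) := by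
    have hne : (genPoly F α (Finset.range n)).map (algebraMap F K) ≠ 0 :=
      ((genPoly_monic α _).map _).ne_zero
    rw [Polynomial.X_pow_sub_one_eq_prod hn hα]
    refine Finset.prod_dvd_of_coprime ?_ fun x hx => ?_
    · intro x _ y _ hxy
      exact Polynomial.isCoprime_X_sub_C_of_isUnit_sub (sub_ne_zero.2 hxy).isUnit
    · have : NeZero n := ⟨hn.ne'⟩
      rw [Polynomial.mem_nthRootsFinset hn] at hx
      obtain ⟨i, hi, rfl⟩ := hα.eq_pow_of_pow_eq_one hx
      rw [Polynomial.dvd_iff_isRoot, Polynomial.IsRoot, Polynomial.eval_map_algebraMap]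
      exact hroot i (Finset.mem_range.2 hi)
  apply le_antisymm
  · refine (Polynomial.natDegree_le_of_dvd h1 fun h0 => ?_).trans_eq hX
    rw [h0, Polynomial.natDegree_zero] at hX
    omega
  · rw [← Polynomial.natDegree_map (algebraMap F K)]
    exact hX'.symm.trans_le
      (Polynomial.natDegree_le_of_dvd h2 ((genPoly_monic α _).map _).ne_zero)

end CyclicCode

section FiniteField

variable {F : Type*} [Field F] [Fintype F] {K : Type*} [Field K] [Algebra F K] [FiniteDimensional F K]

theorem minpoly_eq_minpoly_iff_exists_pow {x y : K} :
    minpoly F x = minpoly F y ↔ ∃ j : ℕ, x ^ Fintype.card F ^ j = y := by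
  have : Finite K := Module.finite_of_finite F
  constructor
  · intro h
    obtain ⟨σ, hσ⟩ := isConjRoot_iff_exists_algEquiv.1 (isConjRoot_def.2 h.symm)
    obtain ⟨j, rfl⟩ := (FiniteField.bijective_frobeniusAlgEquivOfAlgebraic_pow F K).2 σ
    exact ⟨j, by simpa [AlgEquiv.coe_pow, FiniteField.coe_frobeniusAlgEquivOfAlgebraic_iterate] using hσ⟩
  · rintro ⟨j, rfl⟩
    have h := isConjRoot_of_algEquiv (R := F) x ((FiniteField.frobeniusAlgEquivOfAlgebraic F K) ^ j)
    rw [isConjRoot_def] at h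
    rw [h]
    simp [AlgEquiv.coe_pow, FiniteField.coe_frobeniusAlgEquivOfAlgebraic_iterate]

theorem natDegree_minpoly_eq_finrank {x : K}
    (hx : Set.InjOn (fun j => x ^ Fintype.card F ^ j) (Set.Iio (Module.finrank F K))) :
    (minpoly F x).natDegree = Module.finrank F K := by
  classical
  refine le_antisymm (minpoly.natDegree_le x) ?_
  have hint : IsIntegral F x := Algebra.IsIntegral.isIntegral x
  have hsub : (Finset.range (Module.finrank F K)).image (fun j => x ^ Fintype.card F ^ j) ⊆
      ((minpoly F x).aroots K).toFinset := by
    intro y hy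
    obtain ⟨j, -, rfl⟩ := Finset.mem_image.1 hy
    rw [Multiset.mem_toFinset, Polynomial.mem_aroots]
    refine ⟨minpoly.ne_zero hint, ?_⟩
    rw [minpoly_eq_minpoly_iff_exists_pow.2 ⟨j, rfl⟩]
    exact minpoly.aeval F _
  have h1 := Finset.card_le_card hsub
  rw [Finset.card_image_of_injOn (by simpa using hx), Finset.card_range] at h1
  refine h1.trans ((Multiset.toFinset_card_le _).trans ?_)
  refine (Polynomial.card_roots' _).trans_eq ?_
  exact Polynomial.natDegree_map _

theorem IsPrimitiveRoot.pow_eq_pow_iff_modEq {M : Type*} [CommMonoid M] {ζ : M} {n : ℕ} [NeZero n]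
    (hζ : IsPrimitiveRoot ζ n) {a b : ℕ} : ζ ^ a = ζ ^ b ↔ a ≡ b [MOD n] := by
  rw [hζ.eq_orderOf]
  exact IsOfFinOrder.pow_eq_pow_iff_modEq
    (isOfFinOrder_iff_pow_eq_one.2 ⟨n, Nat.pos_of_neZero n, hζ.pow_eq_one⟩)

/-- The cyclic code with nonzeros `α ^ t`, `t ∈ T`, projects onto the coordinates in `S` if no nonzero
word supported in `S` vanishes at all `α ^ (-t)`, `t ∈ T`. -/
theorem exists_mem_cyclicCode_eqOn {n : ℕ} {α : K} (hα : IsPrimitiveRoot α n) {T : Finset ℕ}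
    (hT : ∀ t ∈ T, ∀ l, ∀ z < n, t * Fintype.card F ^ l ≡ z [MOD n] → z ∈ T) {S : Finset (Fin n)}
    (hS : ∀ h : Fin n → F, (∀ t ∈ T, ∑ i ∈ S, algebraMap F K (h i) * ((α ^ t)⁻¹) ^ (i : ℕ) = 0) →
      ∀ i ∈ S, h i = 0) (w : Fin n → F) :
    ∃ v ∈ cyclicCode n (genPoly F α (Finset.range n \ T)), ∀ i ∈ S, v i = w i := by
  classical
  rcases Nat.eq_zero_or_pos n with rfl | hn
  · exact ⟨0, Submodule.zero_mem _, fun i => i.elim0⟩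
  have : NeZero n := ⟨hn.ne'⟩
  let C := cyclicCode n (genPoly F α (Finset.range n \ T))
  let R : (Fin n → F) →ₗ[F] (S → F) := LinearMap.funLeft F F (fun i : S => (i : Fin n))
  suffices h : C.map R = ⊤ by
    have : R w ∈ C.map R := h ▸ Submodule.mem_top
    obtain ⟨v, hv, hvw⟩ := this
    exact ⟨v, hv, fun i hi => congrFun hvw ⟨i, hi⟩⟩
  by_contra hne
  obtain ⟨f, hf0, hf⟩ := Submodule.exists_le_ker_of_lt_top _ (lt_top_iff_ne_top.2 hne)
  let h : Fin n → F := fun i => if hi : i ∈ S then f (Pi.single ⟨i, hi⟩ 1) else 0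
  have hfR (v : Fin n → F) : f (R v) = ∑ i ∈ S, h i * v i := by
    rw [LinearMap.pi_apply_eq_sum_univ f (R v), ← Finset.sum_coe_sort S]
    refine Finset.sum_congr rfl fun i _ => ?_
    have : (fun j : S => if i = j then (1 : F) else 0) = Pi.single i 1 := by
      ext j
      simp [Pi.single_apply, eq_comm]
    simp only [this, smul_eq_mul, h, i.2, dif_pos]
    rw [mul_comm]
    rfl
  have hα0 : α ≠ 0 := hα.ne_zero hn.ne'
  have htr (t : ℕ) (ht : t ∈ T) (β : K) :
      (fun i : Fin n => Algebra.trace F K (β * ((α ^ t)⁻¹) ^ (i : ℕ))) ∈ C := by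
    rw [mem_cyclicCode_genPoly]
    intro z hz
    rw [Finset.mem_sdiff, Finset.mem_range] at hz
    have : Finite K := Module.finite_of_finite F
    simp only [FiniteField.algebraMap_trace_eq_sum_pow F K, Finset.sum_mul]
    rw [Finset.sum_comm]
    refine Finset.sum_eq_zero fun l _ => ?_
    rw [Nat.card_eq_fintype_card]
    set Q := Fintype.card F ^ l
    have hω1 : α ^ z * ((α ^ t)⁻¹) ^ Q ≠ 1 := by
      intro he
      apply hz.2
      refine hT t ht l z hz.1 ?_
      rw [inv_pow, mul_inv_eq_one₀ (pow_ne_zero _ (pow_ne_zero _ hα0)), ← pow_mul] at he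
      exact (hα.pow_eq_pow_iff_modEq.1 he).symm
    have hωn : (α ^ z * ((α ^ t)⁻¹) ^ Q) ^ n = 1 := by
      have h1 (k : ℕ) : (α ^ k) ^ n = 1 := by rw [pow_right_comm, hα.pow_eq_one, one_pow]
      rw [mul_pow, h1, one_mul, pow_right_comm, inv_pow, h1, inv_one, one_pow]
    calc ∑ i : Fin n, (β * ((α ^ t)⁻¹) ^ (i : ℕ)) ^ Q * (α ^ z) ^ (i : ℕ)
        = β ^ Q * ∑ i : Fin n, (α ^ z * ((α ^ t)⁻¹) ^ Q) ^ (i : ℕ) := by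
          rw [Finset.mul_sum]
          refine Finset.sum_congr rfl fun i _ => ?_
          rw [mul_pow, mul_pow, ← pow_mul, mul_comm (i : ℕ) Q, pow_mul]
          ring
      _ = 0 := by
          rw [Fin.sum_univ_eq_sum_range fun i => (α ^ z * ((α ^ t)⁻¹) ^ Q) ^ i,
            geom_sum_eq hω1, hωn, sub_self, zero_div, mul_zero]
  have hh : ∀ i ∈ S, h i = 0 := by
    refine hS h fun t ht => ?_
    refine (traceForm_nondegenerate F K).1 _ fun β => ?_
    rw [Algebra.traceForm_apply]
    have h0 : f (R fun i : Fin n => Algebra.trace F K (β * ((α ^ t)⁻¹) ^ (i : ℕ))) = 0 :=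
      hf ⟨_, htr t ht β, rfl⟩
    rw [hfR] at h0
    rw [← h0, Finset.sum_mul, map_sum]
    refine Finset.sum_congr rfl fun i _ => ?_
    rw [mul_assoc, ← Algebra.smul_def, map_smul, smul_eq_mul, mul_comm _ β]
  apply hf0
  refine LinearMap.ext fun g => ?_
  obtain ⟨v, rfl⟩ := LinearMap.funLeft_surjective_of_injective F F (fun i : S => (i : Fin n))
    Subtype.val_injective g
  change f (R v) = 0
  rw [hfR]
  exact Finset.sum_eq_zero fun i hi => by rw [hh i hi, zero_mul]

end FiniteField

section Cyclotomic

theorem pow_modEq_one_of_eq {q m : ℕ} (hq : 0 < q) : q ^ m ≡ 1 [MOD q ^ m - 1] :=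
  (Nat.modEq_iff_dvd' (Nat.one_le_pow _ _ hq)).2 dvd_rfl |>.symm

theorem mul_pow_ne_of_lt {q m h s t l : ℕ} (hm : h < m) (hs : s < q ^ h) (ht : t < q ^ h)
    (hs0 : ¬ q ∣ s) (ht0 : ¬ q ∣ t) (hl0 : 0 < l) (hl : l + h ≤ m) :
    ¬ s * q ^ l ≡ t [MOD q ^ m - 1] := by
  intro hmod
  have hq : 2 ≤ q := by
    by_contra! hq
    interval_cases q
    · cases h <;> simp_all
    · simp at hs0
  have hpos : 0 < q ^ h := by positivity
  have hlm : q ^ l * q ^ h ≤ q ^ m := by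
    rw [← pow_add]
    exact Nat.pow_le_pow_right (by omega) hl
  have hhm : q ^ h * 2 ≤ q ^ m := by
    calc q ^ h * 2 ≤ q ^ h * q := Nat.mul_le_mul_left _ hq
      _ = q ^ (h + 1) := (pow_succ _ _).symm
      _ ≤ q ^ m := Nat.pow_le_pow_right (by omega) hm
  have hql : 2 ≤ q ^ l := hq.trans (Nat.le_self_pow hl0.ne' q)
  have hlt : s * q ^ l < q ^ m - 1 := by
    have : (s + 1) * q ^ l ≤ q ^ m := by
      calc (s + 1) * q ^ l ≤ q ^ h * q ^ l := Nat.mul_le_mul_right _ hs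
        _ ≤ q ^ m := by rwa [mul_comm]
    rw [add_mul] at this
    omega
  have heq : s * q ^ l = t := Nat.ModEq.eq_of_lt_of_lt hmod hlt (by omega)
  exact ht0 (heq ▸ (dvd_pow_self q hl0.ne').mul_left s)

/-- Numbers below `q ^ ⌈m / 2⌉` that are not divisible by `q` lie in distinct `q`-cosets of size `m`. -/
theorem eq_and_dvd_of_mul_pow_modEq {q m h s t j : ℕ} (hm : h < m) (hh : 2 * h ≤ m + 1)
    (hs : s < q ^ h) (ht : t < q ^ h)
    (hs0 : ¬ q ∣ s) (ht0 : ¬ q ∣ t) (hmod : s * q ^ j ≡ t [MOD q ^ m - 1]) : s = t ∧ m ∣ j := by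
  have hq : 2 ≤ q := by
    by_contra! hq
    interval_cases q
    · cases h <;> simp_all
    · simp at hs0
  have h1 : q ^ m ≡ 1 [MOD q ^ m - 1] := pow_modEq_one_of_eq (by omega)
  have hj : q ^ j ≡ q ^ (j % m) [MOD q ^ m - 1] := by
    conv_lhs => rw [← Nat.div_add_mod j m, pow_add, pow_mul]
    simpa using (h1.pow (j / m)).mul_right (q ^ (j % m))
  have hmod' : s * q ^ (j % m) ≡ t [MOD q ^ m - 1] := (hj.symm.mul_left s).trans hmod
  have hlt : j % m < m := Nat.mod_lt _ (by omega)
  have hjm : j % m = 0 := by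
    by_contra hne
    rcases le_or_gt (j % m + h) m with hle | hgt
    · exact mul_pow_ne_of_lt hm hs ht hs0 ht0 (by omega) hle hmod'
    · refine mul_pow_ne_of_lt (l := m - j % m) hm ht hs ht0 hs0 (by omega) (by omega) ?_
      have h2 := hmod'.symm.mul_right (q ^ (m - j % m))
      rw [mul_assoc, ← pow_add, Nat.add_sub_cancel' hlt.le] at h2
      simpa using h2.trans (h1.mul_left s)
  refine ⟨?_, Nat.dvd_of_mod_eq_zero hjm⟩
  rw [hjm, pow_zero, mul_one] at hmod'
  have hhm : q ^ h * 2 ≤ q ^ m := by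
    calc q ^ h * 2 ≤ q ^ h * q := Nat.mul_le_mul_left _ hq
      _ = q ^ (h + 1) := (pow_succ _ _).symm
      _ ≤ q ^ m := Nat.pow_le_pow_right (by omega) hm
  have : 0 < q ^ h := by positivity
  exact Nat.ModEq.eq_of_lt_of_lt hmod' (by omega) (by omega)

theorem mem_qCoset {q n s t : ℕ} : t ∈ qCoset q n s ↔ t < n ∧ ∃ j : ℕ, s * q ^ j ≡ t [MOD n] := by
  classical
  simp [qCoset]

theorem self_mem_qCoset {q n s : ℕ} (hs : s < n) : s ∈ qCoset q n s :=
  mem_qCoset.2 ⟨hs, 0, by rw [pow_zero, mul_one]⟩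

theorem mem_qCoset_of_mul_pow_modEq {q n s t z l : ℕ} (ht : t ∈ qCoset q n s) (hz : z < n)
    (h : t * q ^ l ≡ z [MOD n]) : z ∈ qCoset q n s := by
  obtain ⟨-, j, hj⟩ := mem_qCoset.1 ht
  refine mem_qCoset.2 ⟨hz, j + l, ?_⟩
  rw [pow_add, ← mul_assoc]
  exact (hj.mul_right _).trans h

end Cyclotomic

section Parameters

variable {F : Type*} [Field F] [Fintype F] {K : Type*} [Field K] [Algebra F K] [FiniteDimensional F K]
  {n : ℕ} [NeZero n] {α : K}

theorem minpoly_pow_eq_iff (hα : IsPrimitiveRoot α n) {s t : ℕ} (ht : t < n) :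
    minpoly F (α ^ s) = minpoly F (α ^ t) ↔ t ∈ qCoset (Fintype.card F) n s := by
  simp only [minpoly_eq_minpoly_iff_exists_pow, mem_qCoset, ht, true_and, ← pow_mul,
    hα.pow_eq_pow_iff_modEq]

theorem natDegree_genPoly_biUnion_qCoset (hα : IsPrimitiveRoot α n) {I : Finset ℕ} {r : ℕ → ℕ}
    (hr : ∀ i ∈ I, r i < n) (hinj : Set.InjOn (fun i => minpoly F (α ^ r i)) I) :
    (genPoly F α (I.biUnion fun i => qCoset (Fintype.card F) n (r i))).natDegree =
      ∑ i ∈ I, (minpoly F (α ^ r i)).natDegree := by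
  classical
  have himg : (I.biUnion fun i => qCoset (Fintype.card F) n (r i)).image
      (fun i => minpoly F (α ^ i)) = I.image fun i => minpoly F (α ^ r i) := by
    ext M
    simp only [Finset.mem_image, Finset.mem_biUnion]
    constructor
    · rintro ⟨z, ⟨i, hi, hz⟩, rfl⟩
      exact ⟨i, hi, (minpoly_pow_eq_iff hα (mem_qCoset.1 hz).1).2 hz⟩
    · rintro ⟨i, hi, rfl⟩
      exact ⟨r i, ⟨i, hi, self_mem_qCoset (hr i hi)⟩, rfl⟩
  have h : genPoly F α (I.biUnion fun i => qCoset (Fintype.card F) n (r i)) =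
      ∏ i ∈ I, minpoly F (α ^ r i) := by
    rw [← Finset.prod_image (f := fun M => M) hinj, ← himg]
    unfold genPoly
    congr!
  rw [h, Polynomial.natDegree_prod_of_monic]
  exact fun i _ => minpoly.monic (Algebra.IsIntegral.isIntegral _)

theorem natDegree_genPoly_sdiff (hα : IsPrimitiveRoot α n) {T : Finset ℕ} (hTn : T ⊆ Finset.range n)
    (hT : ∀ t ∈ T, ∀ l, ∀ z < n, t * Fintype.card F ^ l ≡ z [MOD n] → z ∈ T) :
    (genPoly F α (Finset.range n \ T)).natDegree + (genPoly F α T).natDegree = n := by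
  classical
  have hdisj : Disjoint ((Finset.range n \ T).image fun i => minpoly F (α ^ i))
      (T.image fun i => minpoly F (α ^ i)) := by
    rw [Finset.disjoint_left]
    intro M hM hM'
    obtain ⟨z, hz, rfl⟩ := Finset.mem_image.1 hM
    obtain ⟨t, ht, htz⟩ := Finset.mem_image.1 hM'
    rw [Finset.mem_sdiff, Finset.mem_range] at hz
    obtain ⟨-, l, hl⟩ := mem_qCoset.1 ((minpoly_pow_eq_iff hα hz.1).1 htz)
    exact hz.2 (hT t ht l z hz.1 hl)
  have hmul : genPoly F α (Finset.range n) =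
      genPoly F α (Finset.range n \ T) * genPoly F α T := by
    have := Finset.prod_union (f := fun M : F[X] => M) hdisj
    rw [← Finset.image_union, Finset.sdiff_union_of_subset hTn] at this
    unfold genPoly
    convert this
  rw [← (genPoly_monic α _).natDegree_mul (genPoly_monic α _), ← hmul,
    natDegree_genPoly_range (Nat.pos_of_neZero n) hα]

variable {q m c h k : ℕ}

theorem natDegree_minpoly_pow (hF : Fintype.card F = q) (hK : Module.finrank F K = m)
    (hn : n = q ^ m - 1) (hα : IsPrimitiveRoot α n) (hm : h < m) (hh : 2 * h ≤ m + 1) {s : ℕ}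
    (hs : s < q ^ h) (hs0 : ¬ q ∣ s) : (minpoly F (α ^ s)).natDegree = m := by
  rw [natDegree_minpoly_eq_finrank, hK]
  intro i hi j hj hij
  rw [hK, Set.mem_Iio] at hi hj
  simp only [hF, ← pow_mul, hα.pow_eq_pow_iff_modEq] at hij
  have h1 := hij.mul_right (q ^ (m - i))
  rw [mul_assoc, mul_assoc, ← pow_add, ← pow_add, Nat.add_sub_cancel' hi.le] at h1
  have h2 : s * q ^ m ≡ s [MOD n] := by
    have := (pow_modEq_one_of_eq (q := q) (m := m) (hF ▸ Fintype.card_pos)).mul_left s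
    rwa [← hn, mul_one] at this
  have h3 := h1.symm.trans h2
  rw [hn] at h3
  obtain ⟨x, hx⟩ := (eq_and_dvd_of_mul_pow_modEq hm hh hs hs hs0 hs0 h3).2
  have hx2 : x < 2 := by
    by_contra! hx2
    have := Nat.mul_le_mul_left m hx2
    omega
  interval_cases x <;> omega

theorem minpoly_pow_injOn (hF : Fintype.card F = q)
    (hn : n = q ^ m - 1) (hα : IsPrimitiveRoot α n) (hm : h < m) (hh : 2 * h ≤ m + 1) {s t : ℕ}
    (hs : s < q ^ h) (hs0 : ¬ q ∣ s) (ht : t < q ^ h) (ht0 : ¬ q ∣ t)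
    (hst : minpoly F (α ^ s) = minpoly F (α ^ t)) : s = t := by
  obtain ⟨j, hj⟩ := minpoly_eq_minpoly_iff_exists_pow.1 hst
  rw [← pow_mul, hα.pow_eq_pow_iff_modEq, hF, hn] at hj
  exact (eq_and_dvd_of_mul_pow_modEq hm hh hs ht hs0 ht0 hj).1

/-- The CSS code of the cyclic codes with defining sets `C_0 ∪ … ∪ C_{c-2}` and
`{0, …, n - 1} \ (C_{q+1} ∪ … ∪ C_{(c-1)q+1})`. -/
theorem codeTwo_le_codeOne_and_exists_hasParameters (hF : Fintype.card F = q)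
    (hK : Module.finrank F K = m) (hn : n = q ^ m - 1) (hα : IsPrimitiveRoot α n)
    (hm : h < m) (hh : 2 * h ≤ m + 1) (hc : 2 ≤ c) (hcq : c ≤ q) (hch : (c - 1) * q + 1 < q ^ h)
    (hk0 : 0 < k) (hk : k + m * (2 * c - 3) + 1 = n) :
    codeTwo F q n c α ≤ codeOne F q n c α ∧
      ∃ d : ℕ, c ≤ d ∧ HasParameters (cssCode (codeOne F q n c α) (codeTwo F q n c α)) k d := by
  classical
  subst hF
  set q := Fintype.card F
  set T : Finset ℕ := (Finset.Icc 1 (c - 1)).biUnion fun j => qCoset q n (j * q + 1) with hTdef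
  set Z : Finset ℕ := (Finset.range (c - 1)).biUnion fun i => qCoset q n i with hZdef
  have hqh : q ^ h < n := by
    have h1 : q ^ h * 2 ≤ q ^ m := by
      calc q ^ h * 2 ≤ q ^ h * q := Nat.mul_le_mul_left _ (by omega)
        _ = q ^ (h + 1) := (pow_succ _ _).symm
        _ ≤ q ^ m := Nat.pow_le_pow_right (by omega) hm
    omega
  have hqc : q ≤ (c - 1) * q := Nat.le_mul_of_pos_left _ (by omega)
  have hsmall {i : ℕ} (hi : 1 ≤ i) (hi' : i < c - 1) : i < q ^ h ∧ ¬ q ∣ i :=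
    ⟨by omega, Nat.not_dvd_of_pos_of_lt (by omega) (by omega)⟩
  have hbig {j : ℕ} (hj' : j ≤ c - 1) : j * q + 1 < q ^ h ∧ ¬ q ∣ j * q + 1 := by
    refine ⟨lt_of_le_of_lt (by gcongr) hch, ?_⟩
    rw [Nat.dvd_add_right (Dvd.intro_left j rfl), Nat.dvd_one]
    omega
  have hTn : T ⊆ Finset.range n := by
    intro t ht
    obtain ⟨j, -, hj⟩ := Finset.mem_biUnion.1 ht
    exact Finset.mem_range.2 (mem_qCoset.1 hj).1
  have hTcl : ∀ t ∈ T, ∀ l, ∀ z < n, t * q ^ l ≡ z [MOD n] → z ∈ T := by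
    intro t ht l z hz hlz
    obtain ⟨j, hj, hjt⟩ := Finset.mem_biUnion.1 ht
    exact Finset.mem_biUnion.2 ⟨j, hj, mem_qCoset_of_mul_pow_modEq hjt hz hlz⟩
  have hT0 : (minpoly F (α ^ 0)).natDegree = 1 := by
    rw [pow_zero, minpoly.one]
    exact Polynomial.natDegree_X_sub_C (1 : F)
  have hdegm {s : ℕ} (hs : s < q ^ h ∧ ¬ q ∣ s) : (minpoly F (α ^ s)).natDegree = m :=
    natDegree_minpoly_pow rfl hK hn hα hm hh hs.1 hs.2
  have hinj {s t : ℕ} (hs : s < q ^ h ∧ ¬ q ∣ s) (ht : t < q ^ h ∧ ¬ q ∣ t)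
      (hst : minpoly F (α ^ s) = minpoly F (α ^ t)) : s = t :=
    minpoly_pow_injOn rfl hn hα hm hh hs.1 hs.2 ht.1 ht.2 hst
  have hh1 : 1 < h := by
    by_contra! hle
    have : q ^ h ≤ q ^ 1 := Nat.pow_le_pow_right (by omega) hle
    rw [pow_one] at this
    omega
  have hZT : Disjoint Z T := by
    rw [Finset.disjoint_left]
    intro z hz hz'
    obtain ⟨i, hi, hiz⟩ := Finset.mem_biUnion.1 hz
    obtain ⟨j, hj, hjz⟩ := Finset.mem_biUnion.1 hz'
    rw [Finset.mem_range] at hi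
    rw [Finset.mem_Icc] at hj
    have hzn := (mem_qCoset.1 hiz).1
    have heq := ((minpoly_pow_eq_iff hα hzn).2 hiz).trans ((minpoly_pow_eq_iff hα hzn).2 hjz).symm
    rcases Nat.eq_zero_or_pos i with rfl | hi0
    · have := congrArg Polynomial.natDegree heq
      rw [hT0, hdegm (hbig hj.2)] at this
      omega
    · have h1 := hinj (hsmall hi0 hi) (hbig hj.2) heq
      have h2 : q ≤ j * q := Nat.le_mul_of_pos_left _ hj.1
      omega
  have hdegT : (genPoly F α T).natDegree = m * (c - 1) := by
    rw [hTdef, natDegree_genPoly_biUnion_qCoset (r := fun j => j * q + 1) hα,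
      Finset.sum_congr rfl (g := fun _ => m)]
    · simp [mul_comm]
    · intro j hj
      exact hdegm (hbig (Finset.mem_Icc.1 hj).2)
    · intro j hj
      exact (hbig (Finset.mem_Icc.1 hj).2).1.trans hqh
    · intro i hi j hj hij
      have := hinj (hbig (Finset.mem_Icc.1 hi).2) (hbig (Finset.mem_Icc.1 hj).2) hij
      exact Nat.eq_of_mul_eq_mul_right (by omega) (Nat.add_right_cancel this)
  have hdegZ : (genPoly F α Z).natDegree = m * (c - 2) + 1 := by
    have hc1 : c - 1 = c - 2 + 1 := by omega
    rw [hZdef, natDegree_genPoly_biUnion_qCoset (r := fun i => i) hα, hc1, Finset.sum_range_succ', hT0,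
      Finset.sum_congr rfl (g := fun _ => m)]
    · simp [mul_comm]
    · intro i hi
      rw [Finset.mem_range] at hi
      exact hdegm (hsmall (by omega) (by omega))
    · intro i hi
      rw [Finset.mem_range] at hi
      exact lt_trans (by omega) hqh
    · intro i hi j hj hij
      rw [Finset.mem_coe, Finset.mem_range] at hi hj
      rcases Nat.eq_zero_or_pos i with rfl | hi0 <;> rcases Nat.eq_zero_or_pos j with rfl | hj0
      · rfl
      · have := congrArg Polynomial.natDegree hij
        simp only [] at this
        rw [hT0, hdegm (hsmall hj0 hj)] at this
        omega
      · have := congrArg Polynomial.natDegree hij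
        simp only [] at this
        rw [hT0, hdegm (hsmall hi0 hi)] at this
        omega
      · exact hinj (hsmall hi0 hi) (hsmall hj0 hj) hij
  have hdegT' := natDegree_genPoly_sdiff (F := F) hα hTn hTcl
  have hZsub : Z ⊆ Finset.range n \ T := by
    intro z hz
    rw [Finset.mem_sdiff, Finset.mem_range]
    refine ⟨?_, Finset.disjoint_left.1 hZT hz⟩
    obtain ⟨i, -, hi⟩ := Finset.mem_biUnion.1 hz
    exact (mem_qCoset.1 hi).1
  have hle : codeTwo F q n c α ≤ codeOne F q n c α := by
    have := cyclicCode_genPoly_anti (F := F) (n := n) (α := α) hZsub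
    unfold codeTwo codeOne
    convert this
  have hone : codeOne F q n c α = cyclicCode n (genPoly F α Z) := by
    unfold codeOne
    convert rfl
  have htwo : codeTwo F q n c α = cyclicCode n (genPoly F α (Finset.range n \ T)) := by
    unfold codeTwo
    convert rfl
  have hmc : m * (2 * c - 3) = m * (c - 2) + m * (c - 1) := by
    rw [← mul_add]
    congr 1
    omega
  refine ⟨hle, exists_hasParameters_cssCode hle hk0 ?_ ?_ ?_⟩
  · have h1 := finrank_cyclicCode (n := n) (genPoly_monic (F := F) α Z) (by omega)
    have h2 := finrank_cyclicCode (n := n) (genPoly_monic (F := F) α (Finset.range n \ T)) (by omega)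
    rw [hone, htwo]
    omega
  · intro S hS v hv
    rw [hone] at hv
    refine eq_zero_of_mem_cyclicCode hα (fun j hj => ?_) hv
    exact Finset.mem_biUnion.2 ⟨j, Finset.mem_range.2 (by omega), self_mem_qCoset (by omega)⟩
  · intro S hS w
    rw [htwo]
    refine exists_mem_cyclicCode_eqOn hα hTcl (fun g hg => ?_) w
    have hα0 : α ≠ 0 := hα.ne_zero (NeZero.ne n)
    have hcop : Nat.Coprime q n := by
      rw [hn]
      have : Nat.Coprime (q ^ m) (q ^ m - 1) :=
        (Nat.coprime_self_sub_right (Nat.one_le_pow _ _ (by omega))).2 (Nat.coprime_one_right _)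
      exact Nat.Coprime.coprime_dvd_left (dvd_pow_self q (by omega)) this
    have hβ : IsPrimitiveRoot (α ^ q)⁻¹ n := (hα.pow_of_coprime q hcop).inv
    have key := eq_zero_of_sum_mul_pow_eq_zero (S := S) (a := fun i : Fin n => (α ^ q)⁻¹ ^ (i : ℕ))
      (b := fun i => algebraMap F K (g i) * ((α ^ (q + 1))⁻¹) ^ (i : ℕ))
      (fun i _ j _ hij => Fin.ext (hβ.pow_inj i.2 j.2 hij)) fun j hj => by
        have hmem : (j + 1) * q + 1 ∈ T := Finset.mem_biUnion.2
          ⟨j + 1, Finset.mem_Icc.2 ⟨by omega, by omega⟩,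
            self_mem_qCoset ((hbig (by omega)).1.trans hqh)⟩
        rw [← hg _ hmem]
        refine Finset.sum_congr rfl fun i _ => ?_
        rw [mul_assoc]
        congr 1
        rw [pow_right_comm, ← mul_pow, inv_pow, ← mul_inv, ← pow_mul, ← pow_add]
        congr 3
        ring
    intro i hi
    have h1 := key i hi
    rw [mul_eq_zero] at h1
    simpa using h1.resolve_right (pow_ne_zero _ (inv_ne_zero (pow_ne_zero _ hα0)))

end Parameters

section Existence

/-- A finite field has an extension of every degree, and its unit group is cyclic. -/
theorem exists_extension_isPrimitiveRoot (F : Type*) [Field F] [Fintype F] {m : ℕ} (hm : m ≠ 0) :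
    ∃ (K : Type) (_ : Field K) (_ : Algebra F K) (α : K), Module.finrank F K = m ∧
      IsPrimitiveRoot α (Fintype.card F ^ m - 1) := by
  obtain ⟨p, hp⟩ := CharP.exists F
  have : Fact p.Prime := ⟨CharP.char_is_prime F p⟩
  have : NeZero m := ⟨hm⟩
  let _ : Algebra (ZMod p) F := ZMod.algebra F p
  let K := FiniteField.Extension F p m
  obtain ⟨g, hg⟩ := IsCyclic.exists_generator (α := Kˣ)
  refine ⟨K, inferInstance, inferInstance, g, FiniteField.finrank_extension F p m, ?_⟩
  have h := IsPrimitiveRoot.orderOf (g : K)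
  rwa [orderOf_units, orderOf_eq_card_of_forall_mem_zpowers hg, Nat.card_units,
    FiniteField.natCard_extension, Nat.card_eq_fintype_card] at h

end Existence

theorem mul_add_lt_pow {q m : ℕ} (hq : 3 ≤ q) (hm : 3 ≤ m) : m * (2 * q - 3) + 2 < q ^ m := by
  induction m, hm using Nat.le_induction with
  | base =>
    obtain ⟨r, rfl⟩ := Nat.exists_eq_add_of_le hq
    have : 2 * (3 + r) - 3 = 2 * r + 3 := by omega
    rw [this]
    ring_nf
    nlinarith [Nat.zero_le (r ^ 2), Nat.zero_le (r ^ 3)]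
  | succ m hm ih =>
    have h1 : q ^ m * 3 ≤ q ^ (m + 1) := by
      rw [pow_succ]
      exact Nat.mul_le_mul_left _ hq
    have h2 : 2 * q - 3 ≤ m * (2 * q - 3) := Nat.le_mul_of_pos_left _ (by omega)
    rw [add_mul]
    omega

theorem mainTheorem2 (q m c n : ℕ) (hq : 3 ≤ q) (hm : 2 ≤ m) (hn : n = q ^ m - 1)
    (hc : 2 ≤ c) (hcq : c ≤ q)
    (hcm : ((c : ℤ) - 1) * q + 1 < ⌊(q : ℝ) ^ ⌈(m : ℝ) / 2⌉₊ - 1⌋)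
    (F : Type*) [Field F] [Fintype F] (hF : Fintype.card F = q) :
    ∃ k : ℕ, (k : ℤ) = (n : ℤ) - m * (2 * c - 3) - 1 ∧
      (∃ C₁ C₂ : Submodule F (Fin n → F), C₂ ≤ C₁ ∧
        ∃ d : ℕ, c ≤ d ∧ HasParameters (cssCode C₁ C₂) k d) ∧
      (∀ (K : Type*) [Field K] [Algebra F K], Module.finrank F K = m →
        ∀ α : K, IsPrimitiveRoot α n →
          codeTwo F q n c α ≤ codeOne F q n c α ∧
          ∃ d : ℕ, c ≤ d ∧ HasParameters (cssCode (codeOne F q n c α) (codeTwo F q n c α)) k d) := by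
  obtain ⟨h, hdef⟩ : ∃ h, h = ⌈(m : ℝ) / 2⌉₊ := ⟨_, rfl⟩
  rw [← hdef] at hcm
  have hh : 2 * h ≤ m + 1 := by
    have h1 : (h : ℝ) < (m : ℝ) / 2 + 1 := hdef ▸ Nat.ceil_lt_add_one (by positivity)
    have h2 : ((2 * h : ℕ) : ℝ) < ((m + 2 : ℕ) : ℝ) := by
      push_cast
      linarith
    have := Nat.cast_lt.1 h2
    omega
  have hch : (c - 1) * q + 1 < q ^ h := by
    have h1 : ⌊(q : ℝ) ^ h - 1⌋ = (q : ℤ) ^ h - 1 := by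
      rw [Int.floor_sub_one]
      congr 1
      exact_mod_cast Int.floor_natCast (R := ℝ) (q ^ h)
    rw [h1] at hcm
    zify [show 1 ≤ c by omega]
    linarith
  have hh1 : 1 < h := by
    by_contra! hle
    have h1 : q ^ h ≤ q ^ 1 := Nat.pow_le_pow_right (by omega) hle
    rw [pow_one] at h1
    have h2 : q ≤ (c - 1) * q := Nat.le_mul_of_pos_left _ (by omega)
    omega
  have hhm : h < m := by omega
  have hlt := mul_add_lt_pow hq (show 3 ≤ m by omega)
  have hle : m * (2 * c - 3) ≤ m * (2 * q - 3) := Nat.mul_le_mul_left _ (by omega)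
  have hn0 : NeZero n := ⟨by omega⟩
  obtain ⟨k, hk⟩ : ∃ k, k + m * (2 * c - 3) + 1 = n := ⟨n - 1 - m * (2 * c - 3), by omega⟩
  have hk0 : 0 < k := by omega
  refine ⟨k, ?_, ?_, ?_⟩
  · rw [← hk]
    push_cast [Nat.cast_sub (show 3 ≤ 2 * c by omega)]
    ring
  · obtain ⟨K, _, _, α, hK, hα⟩ := exists_extension_isPrimitiveRoot F (show m ≠ 0 by omega)
    have : FiniteDimensional F K := Module.finite_of_finrank_pos (by omega)
    rw [hF, ← hn] at hα
    obtain ⟨h1, h2⟩ := codeTwo_le_codeOne_and_exists_hasParameters hF hK hn hα hhm hh hc hcq hch hk0 hk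
    exact ⟨_, _, h1, h2⟩
  · intro K _ _ hK α hα
    have : FiniteDimensional F K := Module.finite_of_finrank_pos (by omega)
    exact codeTwo_le_codeOne_and_exists_hasParameters hF hK hn hα hhm hh hc hcq hch hk0 hk
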